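/- Let $M=(V,\Gamma,\delta)$ be a finite MDP: $V$ and $\Gamma$ are finite, each state $v$ has a nonempty set $\Gamma_v\subseteq\Gamma$ of enabled actions, and playing $\gamma\in\Gamma_v$ at $v$ leads to $v'$ with probability $p_{(v,\gamma,v')}\ge 0$, where $\sum_{v'\in V}p_{(v,\gamma,v')}\le 1$; the residual probability is that of moving to an implicit absorbing dead state outside $V$. A strategy $\sigma$ maps each finite history in $(V\Gamma)^*V$ ending in $v$ to a probability distribution on $\Gamma_v$; it is memoryless if it depends only on the last state. $\Pr^\sigma_\alpha(\Diamond T)$ is the probability that the run induced by $\sigma$ and the initial distribution $\alpha$ visits $T$. Let $F_1,\dots,F_k\subseteq V$ be target sets, possibly overlapping, and $F=\bigcup_i F_i$. Suppose that every $v\in F$ is absorbing (it has exactly one enabled action, which leads back to $v$ with probability $1$) and that $M$ is cleaned-up: for every $v\in V\setminus F$ some strategy $\sigma$ has $\Pr^\sigma_v(\Diamond F)>0$. Let $\alpha$ be a probability distribution on $V\setminus F$. Consider the following linear constraints in variables $y_v$ ($v\in F$) and $y_{(v,\gamma)}$ ($v\in V\setminus F$, $\gamma\in\Gamma_v$), all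 required to be $\ge 0$: \[\sum_{\gamma\in\Gamma_v}y_{(v,\gamma)}-\sum_{v'\in V\setminus F}\sum_{\gamma'\in\Gamma_{v'}}p_{(v',\gamma',v)}\,y_{(v',\gamma')}=\alpha(v)\quad(v\in V\setminus F),\] \[y_v-\sum_{v'\in V\setminus F}\sum_{\gamma'\in\Gamma_{v'}}p_{(v',\gamma',v)}\,y_{(v',\gamma')}=0\quad(v\in F).\tag{LP}\] Theorem. For every $r\in(0,1]^k$ the following are equivalent: (1) there is a (possibly randomized) memoryless strategy $\sigma$ with $\Pr^\sigma_\alpha(\Diamond F_i)\ge r_i$ for all $i$; (2) there is a solution $y$ of (LP) with $\sum_{v\in F_i}y_v\ge r_i$ for all $i$; (3) there is an arbitrary strategy $\sigma$ with $\Pr^\sigma_\alpha(\Diamond F_i)\ge r_i$ for all $i$. Moreover, for every strategy $\sigma$ there is a memoryless strategy $\tau$ with $\Pr^\tau_\alpha(\Diamond F_i)\ge\Pr^\sigma_\alpha(\Diamond F_i)$ for all $i$; and the achievable set $\{r\in\mathbb R_{\ge0}^k : \exists\sigma\ \forall i\ \Pr^\sigma_\alpha(\Diamond F_i)\ge r_i\}$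 is convex and is the projection onto the $r$-coordinates of the polyhedron of all $(y,r)$ such that $y$ solves (LP) and $0\le r_i\le\sum_{v\in F_i}y_v$ for all $i$. -/

import Mathlib

open MeasureTheory ProbabilityTheory
open scoped ENNReal

/-- A finite Markov decision process with state set `V` and action alphabet `Γ`.  Transition
probabilities out of a state under an enabled action may sum to less than `1`; the residual
probability is that of moving to an implicit absorbing dead state, which belongs to no target
set and is not an element of `V`. -/
structure MDP (V Γ : Type*) [Fintype V] where
  /-- the set `Γ_v` of enabled actions -/
  enabled : V → Finset Γ
  /-- `prob v γ v'` is `p_{(v,γ,v')}` -/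
  prob : V → Γ → V → ℝ
  enabled_nonempty : ∀ v, (enabled v).Nonempty
  prob_nonneg : ∀ v γ v', 0 ≤ prob v γ v'
  sum_prob_le_one : ∀ v γ, ∑ v', prob v γ v' ≤ 1
  /-- there are no transitions on disabled actions -/
  prob_eq_zero : ∀ v γ v', γ ∉ enabled v → prob v γ v' = 0

/-- States of the Markov chain of histories: `some (w, v)` is the history `w v ∈ (VΓ)*V`, with
`w` listed in chronological order, and `none` is the dead state. -/
def RunState (V Γ : Type*) : Type _ := Option (List (V × Γ) × V)

/-- Every set of histories is measurable (there are only countably many histories). -/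
instance RunState.instMeasurableSpace (V Γ : Type*) : MeasurableSpace (RunState V Γ) := ⊤

namespace MDP

variable {V Γ : Type*} [Fintype V]

lemma sum_option_prob (M : MDP V Γ) (v : V) (γ : Γ) :
    ∑ o : Option V, ENNReal.ofReal
      (o.elim (1 - ∑ v', M.prob v γ v') (fun v' => M.prob v γ v')) = 1 := by
  rw [← ENNReal.ofReal_sum_of_nonneg]
  · simp [Fintype.sum_option]
  · rintro (_ | v') -
    · simpa using M.sum_prob_le_one v γ
    · exact M.prob_nonneg v γ v'

/-- The distribution of the next state when `γ` is played at `v`; `none` is the dead state. -/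
noncomputable def next (M : MDP V Γ) (v : V) (γ : Γ) : PMF (Option V) :=
  PMF.ofFintype
    (fun o => ENNReal.ofReal (o.elim (1 - ∑ v', M.prob v γ v') (fun v' => M.prob v γ v')))
    (M.sum_option_prob v γ)

/-- The state `v` is absorbing: it has exactly one enabled action, a self-loop taken with
probability `1`. -/
def IsAbsorbing (M : MDP V Γ) (v : V) : Prop :=
  ∃ a, M.enabled v = {a} ∧ M.prob v a v = 1

/-- A strategy maps every history `w v ∈ (VΓ)*V` to a probability distribution on the actions
enabled at `v`. -/
structure Strategy (M : MDP V Γ) where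
  choice : List (V × Γ) → V → PMF Γ
  support_subset : ∀ w v, ∀ γ ∈ (choice w v).support, γ ∈ M.enabled v

/-- A strategy is memoryless if it depends only on the last state of the history. -/
def Strategy.IsMemoryless {M : MDP V Γ} (σ : M.Strategy) : Prop :=
  ∀ w w' v, σ.choice w v = σ.choice w' v

/-- One step of the Markov chain of histories induced by `σ`: from `w v`, an action `γ` is drawn
from `σ(w v)`, a successor `v'` from the distribution of `γ` at `v`, and the new history is
`w v γ v'`.  The dead state is never left. -/
noncomputable def stepPMF (M : MDP V Γ) (σ : M.Strategy) : RunState V Γ → PMF (RunState V Γ)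
  | none => PMF.pure none
  | some (w, v) => (σ.choice w v).bind fun γ =>
      (M.next v γ).map (Option.map fun v' => (w ++ [(v, γ)], v'))

/-- The transition kernel of the Markov chain of histories. -/
noncomputable def stepKernel (M : MDP V Γ) (σ : M.Strategy) :
    Kernel (RunState V Γ) (RunState V Γ) where
  toFun h := (M.stepPMF σ h).toMeasure
  measurable' := measurable_from_top

instance (M : MDP V Γ) (σ : M.Strategy) : IsMarkovKernel (M.stepKernel σ) :=
  ⟨fun h => inferInstanceAs (IsProbabilityMeasure (M.stepPMF σ h).toMeasure)⟩

/-- The law of the initial history (of length zero) for the initial distribution `α`. -/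
noncomputable def initMeasure (α : PMF V) : Measure (RunState V Γ) :=
  (PMF.map (β := RunState V Γ) (fun v => some ([], v)) α).toMeasure

instance (α : PMF V) : IsProbabilityMeasure (initMeasure (Γ := Γ) α) :=
  inferInstanceAs (IsProbabilityMeasure
    (PMF.map (β := RunState V Γ) (fun v => some ([], v)) α).toMeasure)

/-- The law of the infinite run `θ₀ θ₁ …` of the Markov chain of histories induced by the
strategy `σ` and the initial distribution `α`. -/
noncomputable def runMeasure (M : MDP V Γ) (σ : M.Strategy) (α : PMF V) :
    Measure (ℕ → RunState V Γ) :=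
  Kernel.trajMeasure (X := fun _ => RunState V Γ) (initMeasure α)
    (fun n => (M.stepKernel σ).comap
      (fun h : (i : Finset.Iic n) → RunState V Γ => h ⟨n, Finset.mem_Iic.2 le_rfl⟩)
      (measurable_pi_apply _))

/-- The set of runs that visit `T`. -/
def reachEvent (T : Finset V) : Set (ℕ → RunState V Γ) :=
  {θ | ∃ n w v, θ n = some (w, v) ∧ v ∈ T}

/-- `Pr^σ_α(◇T)`, the probability of reaching `T`. -/
noncomputable def reachProb (M : MDP V Γ) (σ : M.Strategy) (α : PMF V) (T : Finset V) : ℝ :=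
  (M.runMeasure σ α).real (reachEvent T)

/-- `M` is cleaned-up with respect to the goal set `F`: from every state outside `F`, some
strategy reaches `F` with positive probability. -/
def IsCleanedUp (M : MDP V Γ) (F : Finset V) : Prop :=
  ∀ v, v ∉ F → ∃ σ : M.Strategy, 0 < M.reachProb σ (PMF.pure v) F

/-- The set of nonnegative vectors achievable by arbitrary strategies. -/
def achievableSet {k : ℕ} (M : MDP V Γ) (F : Fin k → Finset V) (α : PMF V) :
    Set (Fin k → ℝ) :=
  {r | (∀ i, 0 ≤ r i) ∧ ∃ σ : M.Strategy, ∀ i, r i ≤ M.reachProb σ α (F i)}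

variable [DecidableEq V]

/-- `F = F_1 ∪ … ∪ F_k` -/
def goal {k : ℕ} (F : Fin k → Finset V) : Finset V := Finset.univ.biUnion F

/-- Feasibility for the flow linear program with goal set `G` and initial distribution `α`.
The variables are `y.1 v` for `v ∈ G` and `y.2 v γ` for `v ∉ G`, `γ ∈ Γ_v`; all other
coordinates of `y` are ignored.  Inflow is summed over the states outside `G`, where alone there
are action variables (the goal states are absorbing, so nothing flows out of them). -/
structure LPFeasible (M : MDP V Γ) (G : Finset V) (α : PMF V)
    (y : (V → ℝ) × (V → Γ → ℝ)) : Prop where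
  flow : ∀ v, v ∉ G →
    ∑ γ ∈ M.enabled v, y.2 v γ
      - ∑ v' ∈ Gᶜ, ∑ γ' ∈ M.enabled v', M.prob v' γ' v * y.2 v' γ' = (α v).toReal
  flow_goal : ∀ v ∈ G,
    y.1 v - ∑ v' ∈ Gᶜ, ∑ γ' ∈ M.enabled v', M.prob v' γ' v * y.2 v' γ' = 0
  nonneg_goal : ∀ v ∈ G, 0 ≤ y.1 v
  nonneg : ∀ v, v ∉ G → ∀ γ ∈ M.enabled v, 0 ≤ y.2 v γ

/-- Pairs `(y, r)` such that `y` is feasible for the flow linear program, `r ≥ 0`, and the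
objectives of `y` are at least `r`. -/
def lpPolyhedron {k : ℕ} (M : MDP V Γ) (F : Fin k → Finset V) (α : PMF V) :
    Set (((V → ℝ) × (V → Γ → ℝ)) × (Fin k → ℝ)) :=
  {x | M.LPFeasible (goal F) α x.1 ∧ ∀ i, 0 ≤ x.2 i ∧ x.2 i ≤ ∑ v ∈ F i, x.1.1 v}

end MDP

/-- A subset of a real vector space is a polyhedron if it is the solution set of finitely many
(non-strict) linear inequalities. -/
def IsPolyhedron {E : Type*} [AddCommGroup E] [Module ℝ E] (P : Set E) : Prop :=
  ∃ S : Finset ((E →ₗ[ℝ] ℝ) × ℝ), P = {x | ∀ c ∈ S, c.1 x ≤ c.2}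

open Filter Topology

/-! Everything is read off from two numbers: the probability `occ` of being in `v` at time `n`, and
the probability `occAct` of also playing `γ` there. They satisfy a linear forward recursion, and for
absorbing targets the reachability probability is the limit of the occupation probabilities.

From (LP) to strategies: play each action with probability proportional to its flow. The resulting
chain may realize less than the given flow, but the expected visits are the least nonnegative
solution of the flow equations. The excess is a circulation among the non-goal states; since rows
have sum at most 1, it sends nothing into the goal, so every goal state receives exactly its
`y`-value (`tendsto_absorbed_mass`, `LPFeasible.exists_memoryless`).

From strategies to (LP): the expected visits under an arbitrary strategy may be infinite, so they
cannot serve as `y`. Duality replaces them. A nonnegative weighting of the targets, extended to a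
function that no action increases in expectation, bounds the weighted reachability probabilities of
every strategy (`sum_mul_reachProb_le`). Being cleaned-up enters through a minimum principle, which
makes such functions nonnegative. Farkas' lemma turns these bounds into a feasible flow dominating
the strategy (`exists_lpFeasible`).

Both passages together give the equivalences and the projection formula; convexity is inherited from
the polyhedron. -/

instance RunState.instDiscreteMeasurableSpace (V Γ : Type*) :
    DiscreteMeasurableSpace (RunState V Γ) := ⟨fun _ => trivial⟩

instance RunState.instCountable (V Γ : Type*) [Countable V] [Countable Γ] :
    Countable (RunState V Γ) :=
  inferInstanceAs (Countable (Option (List (V × Γ) × V)))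

/-! ### Histories and their last states -/

namespace RunState

variable {V Γ : Type*}

/-- The dead state. -/
def dead : RunState V Γ := none

/-- The history `w v`. -/
def mk (w : List (V × Γ)) (v : V) : RunState V Γ := some (w, v)

/-- Appends the next state to a history, where `none` is the dead state. -/
def extend (w : List (V × Γ)) : Option V → RunState V Γ := Option.map fun v => (w, v)

lemma eq_dead_or_mk (h : RunState V Γ) : h = dead ∨ ∃ w v, h = mk w v := by
  rcases h with _ | ⟨w, v⟩
  · exact Or.inl rfl
  · exact Or.inr ⟨w, v, rfl⟩

/-- The last state of a history, `none` for the dead state. -/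
def last (h : RunState V Γ) : Option V := Option.map Prod.snd h

@[simp] lemma last_dead : (dead : RunState V Γ).last = none := rfl

@[simp] lemma last_extend (w : List (V × Γ)) (o : Option V) : (extend w o).last = o := by
  cases o <;> rfl

@[simp] lemma last_mk (w : List (V × Γ)) (v : V) : (mk w v).last = some v := rfl

/-- The indicator function of the histories that end in `v`. -/
noncomputable def atState (v : V) : RunState V Γ → ℝ≥0∞ := Set.indicator {h | h.last = some v} 1

lemma atState_of_eq {v : V} {h : RunState V Γ} (hv : h.last = some v) : atState v h = 1 := by
  simp [atState, hv]

lemma atState_of_ne {v : V} {h : RunState V Γ} (hv : h.last ≠ some v) : atState v h = 0 := by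
  simp [atState, hv]

lemma measurable_eval (n : ℕ) {β : Type*} [MeasurableSpace β] (f : RunState V Γ → β) :
    Measurable fun θ : ℕ → RunState V Γ => f (θ n) :=
  Measurable.of_discrete.comp (measurable_pi_apply n)

lemma measurableSet_last (n : ℕ) (v : V) :
    MeasurableSet {θ : ℕ → RunState V Γ | (θ n).last = some v} :=
  have h : Measurable fun θ : ℕ → RunState V Γ => θ n := measurable_pi_apply n
  h (MeasurableSet.of_discrete (s := {h : RunState V Γ | h.last = some v}))

lemma lintegral_atState (μ : Measure (RunState V Γ)) (v : V) :
    ∫⁻ h, atState v h ∂μ = μ {h | h.last = some v} :=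
  lintegral_indicator_one MeasurableSet.of_discrete

lemma lintegral_run_atState (μ : Measure (ℕ → RunState V Γ)) (n : ℕ) (v : V) :
    ∫⁻ θ, atState v (θ n) ∂μ = μ {θ | (θ n).last = some v} :=
  lintegral_indicator_one (μ := μ) (measurableSet_last n v)

end RunState

/-! ### Occupation probabilities of the run and their recursion -/

namespace MDP

variable {V Γ : Type*} [Fintype V] (M : MDP V Γ) (σ : M.Strategy) (α : PMF V)

instance : IsProbabilityMeasure (M.runMeasure σ α) := by
  unfold runMeasure; infer_instance

lemma lintegral_run_zero (f : RunState V Γ → ℝ≥0∞) :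
    ∫⁻ θ, f (θ 0) ∂M.runMeasure σ α = ∫⁻ h, f h ∂initMeasure (Γ := Γ) α := by
  have hf : Measurable f := Measurable.of_discrete
  have hm : Measurable fun p : (i : Finset.Iic 0) → RunState V Γ =>
    f (p ⟨0, Finset.mem_Iic.2 le_rfl⟩) := by fun_prop
  have h0 : Measurable fun θ : ℕ → RunState V Γ => f (θ 0) := by fun_prop
  unfold runMeasure Kernel.trajMeasure
  rw [Measure.lintegral_bind (Kernel.aemeasurable _) h0.aemeasurable,
    lintegral_map (h0.lintegral_kernel) (by fun_prop)]
  refine lintegral_congr fun h => ?_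
  -- Restricted to the coordinates up to time 0, the trajectory kernel started at time 0 makes no
  -- step, so it is the identity kernel.
  have h1 := Kernel.traj_map_frestrictLe_apply (X := fun _ => RunState V Γ)
    (κ := fun n => (M.stepKernel σ).comap
      (fun h : (i : Finset.Iic n) → RunState V Γ => h ⟨n, Finset.mem_Iic.2 le_rfl⟩)
      (measurable_pi_apply _)) 0 0
      ((MeasurableEquiv.piUnique (fun _ : Finset.Iic 0 => RunState V Γ)).symm h)
  have h2 := congrArg (fun μ => ∫⁻ p, f (p ⟨0, Finset.mem_Iic.2 le_rfl⟩) ∂μ) h1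
  beta_reduce at h2
  rw [lintegral_map hm (by fun_prop), Kernel.partialTraj_self, Kernel.id_apply,
    lintegral_dirac' _ hm] at h2
  exact h2

/-- The conditional probability, given the history, of being in `v` and playing `γ` next. -/
noncomputable def actProb [DecidableEq V] (v : V) (γ : Γ) : RunState V Γ → ℝ≥0∞
  | none => 0
  | some (w, u) => if u = v then σ.choice w v γ else 0

@[simp] lemma actProb_dead [DecidableEq V] (v : V) (γ : Γ) :
    M.actProb σ v γ RunState.dead = 0 := rfl

@[simp] lemma actProb_mk [DecidableEq V] (v : V) (γ : Γ) (w : List (V × Γ)) (u : V) :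
    M.actProb σ v γ (RunState.mk w u) = if u = v then σ.choice w v γ else 0 := rfl

lemma actProb_le_one [DecidableEq V] (h : RunState V Γ) (v : V) (γ : Γ) :
    M.actProb σ v γ h ≤ 1 := by
  obtain rfl | ⟨w, u, rfl⟩ := h.eq_dead_or_mk
  · simp
  · rw [actProb_mk]
    split_ifs
    · exact PMF.coe_le_one _ _
    · simp

lemma actProb_eq_zero [DecidableEq V] {v : V} {γ : Γ} (hγ : γ ∉ M.enabled v)
    (h : RunState V Γ) : M.actProb σ v γ h = 0 := by
  obtain rfl | ⟨w, u, rfl⟩ := h.eq_dead_or_mk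
  · simp
  · rw [actProb_mk, ite_eq_right_iff]
    intro _
    by_contra h0
    exact hγ (σ.support_subset w v γ ((PMF.mem_support_iff _ _).2 h0))

lemma lintegral_actProb_ne_top [DecidableEq V] (n : ℕ) (v : V) (γ : Γ) :
    ∫⁻ θ, M.actProb σ v γ (θ n) ∂M.runMeasure σ α ≠ ∞ := by
  refine ne_top_of_le_ne_top ENNReal.one_ne_top
    ((lintegral_mono (g := fun _ => 1) fun θ : ℕ → RunState V Γ => M.actProb_le_one σ (θ n) v γ).trans ?_)
  simp

/-- The probability that the run is in `v` at time `n`. -/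
noncomputable def occ (n : ℕ) (v : V) : ℝ :=
  (M.runMeasure σ α).real {θ | (θ n).last = some v}

/-- The probability that the run is in `v` at time `n` and `γ` is played there. -/
noncomputable def occAct [DecidableEq V] (n : ℕ) (v : V) (γ : Γ) : ℝ :=
  (∫⁻ θ, M.actProb σ v γ (θ n) ∂M.runMeasure σ α).toReal

lemma occ_nonneg (n : ℕ) (v : V) : 0 ≤ M.occ σ α n v := measureReal_nonneg

lemma occAct_nonneg [DecidableEq V] (n : ℕ) (v : V) (γ : Γ) : 0 ≤ M.occAct σ α n v γ :=
  ENNReal.toReal_nonneg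

lemma occAct_eq_zero [DecidableEq V] {v : V} {γ : Γ} (hγ : γ ∉ M.enabled v) (n : ℕ) :
    M.occAct σ α n v γ = 0 := by
  simp [occAct, M.actProb_eq_zero σ hγ]

lemma occ_zero (v : V) : M.occ σ α 0 v = (α v).toReal := by
  have := M.lintegral_run_zero σ α (RunState.atState v)
  rw [RunState.lintegral_run_atState, RunState.lintegral_atState] at this
  rw [occ, measureReal_def, this]
  change ((PMF.map (RunState.mk []) α).toMeasure {h : RunState V Γ | h.last = some v}).toReal = _
  rw [PMF.toMeasure_apply_eq_toOuterMeasure, PMF.toOuterMeasure_map_apply,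
    show (RunState.mk [] ⁻¹' {h : RunState V Γ | h.last = some v}) = {v} by ext u; simp,
    PMF.toOuterMeasure_apply_singleton]

lemma Strategy.IsMemoryless.occAct_eq [DecidableEq V] {M : MDP V Γ} {σ : M.Strategy}
    (hσ : σ.IsMemoryless) (α : PMF V) (n : ℕ) (v : V) (γ : Γ) :
    M.occAct σ α n v γ = M.occ σ α n v * (σ.choice [] v γ).toReal := by
  have : ∀ h : RunState V Γ, M.actProb σ v γ h = RunState.atState v h * σ.choice [] v γ := by
    intro h
    obtain rfl | ⟨w, u, rfl⟩ := h.eq_dead_or_mk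
    · rw [RunState.atState_of_ne (by simp)]; simp
    · by_cases hu : u = v
      · rw [RunState.atState_of_eq (by simp [hu])]
        simp [hu, hσ w [] v]
      · rw [RunState.atState_of_ne (by simp [hu])]
        simp [hu]
  simp only [occAct, this]
  rw [lintegral_mul_const _ (RunState.measurable_eval n _), RunState.lintegral_run_atState,
    ENNReal.toReal_mul]
  rfl

variable [Fintype Γ]

/-- The Markov property of the chain of histories, for a function of two consecutive histories. -/
lemma lintegral_run_succ (n : ℕ) (f : RunState V Γ → RunState V Γ → ℝ≥0∞) :
    ∫⁻ θ, f (θ n) (θ (n + 1)) ∂M.runMeasure σ α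
      = ∫⁻ θ, ∫⁻ h, f (θ n) h ∂M.stepKernel σ (θ n) ∂M.runMeasure σ α := by
  -- The kernel sees the path up to time `n` only through its last coordinate, so the joint law of
  -- path and next history yields the one-step formula.
  have key := Kernel.map_frestrictLe_trajMeasure_compProd_eq_map_trajMeasure
    (X := fun _ => RunState V Γ) (μ₀ := initMeasure (Γ := Γ) α)
    (κ := fun n => (M.stepKernel σ).comap
      (fun h : (i : Finset.Iic n) → RunState V Γ => h ⟨n, Finset.mem_Iic.2 le_rfl⟩)
      (measurable_pi_apply _)) (a := n)
  have hf : Measurable (Function.uncurry f) := Measurable.of_discrete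
  have hmeas : Measurable fun p : ((i : Finset.Iic n) → RunState V Γ) × RunState V Γ =>
      f (p.1 ⟨n, Finset.mem_Iic.2 le_rfl⟩) p.2 := by
    have h1 : Measurable fun p : ((i : Finset.Iic n) → RunState V Γ) × RunState V Γ =>
      p.1 ⟨n, Finset.mem_Iic.2 le_rfl⟩ := by fun_prop
    exact hf.comp (h1.prodMk measurable_snd)
  have h2 := congrArg (fun μ => ∫⁻ p, f (p.1 ⟨n, Finset.mem_Iic.2 le_rfl⟩) p.2 ∂μ) key
  beta_reduce at h2
  rw [Measure.lintegral_compProd hmeas, lintegral_map hmeas.lintegral_kernel_prod_right'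
    (by fun_prop), lintegral_map hmeas (by fun_prop)] at h2
  exact h2.symm

/-- Summing over all states and actions, not only those at the end of `h`, makes the right-hand side
linear in `actProb`; integrating it gives `occ_succ`. -/
lemma stepKernel_last_eq [DecidableEq V] (h : RunState V Γ) (v' : V) :
    M.stepKernel σ h {h' | h'.last = some v'}
      = ∑ v, ∑ γ, M.actProb σ v γ h * ENNReal.ofReal (M.prob v γ v') := by
  change (M.stepPMF σ h).toMeasure _ = _
  rw [PMF.toMeasure_apply_eq_toOuterMeasure]
  obtain rfl | ⟨w, u, rfl⟩ := h.eq_dead_or_mk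
  · change (PMF.pure RunState.dead).toOuterMeasure _ = _
    rw [PMF.toOuterMeasure_pure_apply, if_neg (by simp)]
    simp
  · change ((σ.choice w u).bind fun γ => (M.next u γ).map
      (RunState.extend (w ++ [(u, γ)]))).toOuterMeasure _ = _
    rw [PMF.toOuterMeasure_bind_apply, tsum_fintype, Finset.sum_eq_single u]
    · refine Finset.sum_congr rfl fun γ _ => ?_
      rw [actProb_mk, if_pos rfl, PMF.toOuterMeasure_map_apply,
        show (RunState.extend (w ++ [(u, γ)]) ⁻¹' {h' | h'.last = some v'}) = {some v'} by
          ext o; simp, PMF.toOuterMeasure_apply_singleton]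
      simp [next]
    · intro v _ hv
      simp [hv.symm]
    · simp

lemma sum_actProb [DecidableEq V] (h : RunState V Γ) (v : V) :
    ∑ γ, M.actProb σ v γ h = RunState.atState v h := by
  obtain rfl | ⟨w, u, rfl⟩ := h.eq_dead_or_mk
  · rw [RunState.atState_of_ne (by simp)]; simp
  · by_cases hu : u = v
    · have := (σ.choice w v).tsum_coe
      rw [tsum_fintype] at this
      rw [RunState.atState_of_eq (by simp [hu])]
      simp [hu, this]
    · rw [RunState.atState_of_ne (by simp [hu])]
      simp [hu]

lemma sum_enabled_occAct [DecidableEq V] (n : ℕ) (v : V) :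
    ∑ γ ∈ M.enabled v, M.occAct σ α n v γ = M.occ σ α n v := by
  rw [Finset.sum_subset (Finset.subset_univ _)
    fun γ _ hγ => M.occAct_eq_zero σ α hγ n]
  simp only [occAct]
  rw [← ENNReal.toReal_sum fun γ _ => M.lintegral_actProb_ne_top σ α n v γ,
    ← lintegral_finsetSum _ fun γ _ => RunState.measurable_eval n (M.actProb σ v γ)]
  simp only [M.sum_actProb, RunState.lintegral_run_atState]
  rfl

lemma occ_succ [DecidableEq V] (n : ℕ) (v' : V) :
    M.occ σ α (n + 1) v'
      = ∑ v, ∑ γ ∈ M.enabled v, M.prob v γ v' * M.occAct σ α n v γ := by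
  have := M.lintegral_run_succ σ α n (fun _ => RunState.atState v')
  rw [RunState.lintegral_run_atState] at this
  simp only [RunState.lintegral_atState, stepKernel_last_eq] at this
  rw [lintegral_finsetSum _ fun v _ => RunState.measurable_eval n
    (fun h => ∑ γ, M.actProb σ v γ h * ENNReal.ofReal (M.prob v γ v'))] at this
  rw [occ, measureReal_def, this]
  have hfin : ∀ v γ, (∫⁻ θ, M.actProb σ v γ (θ n) ∂M.runMeasure σ α)
      * ENNReal.ofReal (M.prob v γ v') ≠ ∞ := fun v γ =>
    ENNReal.mul_ne_top (M.lintegral_actProb_ne_top σ α n v γ) ENNReal.ofReal_ne_top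
  have hstep : ∀ v, ∫⁻ θ, ∑ γ, M.actProb σ v γ (θ n) * ENNReal.ofReal (M.prob v γ v')
      ∂M.runMeasure σ α = ∑ γ, (∫⁻ θ, M.actProb σ v γ (θ n) ∂M.runMeasure σ α)
      * ENNReal.ofReal (M.prob v γ v') := fun v => by
    rw [lintegral_finsetSum _ fun γ _ => RunState.measurable_eval n
      (fun h => M.actProb σ v γ h * ENNReal.ofReal (M.prob v γ v'))]
    exact Finset.sum_congr rfl fun γ _ =>
      lintegral_mul_const _ (RunState.measurable_eval n (M.actProb σ v γ))
  rw [Finset.sum_congr rfl fun v _ => hstep v,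
    ENNReal.toReal_sum fun v _ => ENNReal.sum_ne_top.2 fun γ _ => hfin v γ]
  refine Finset.sum_congr rfl fun v _ => ?_
  rw [ENNReal.toReal_sum fun γ _ => hfin v γ, Finset.sum_subset (Finset.subset_univ (M.enabled v))
    fun γ _ hγ => by rw [M.occAct_eq_zero σ α hγ n, mul_zero]]
  refine Finset.sum_congr rfl fun γ _ => ?_
  rw [ENNReal.toReal_mul, ENNReal.toReal_ofReal (M.prob_nonneg _ _ _), mul_comm]
  rfl

variable {M}

lemma IsAbsorbing.stepKernel_last_ne {v : V} (hv : M.IsAbsorbing v) {h : RunState V Γ}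
    (hh : h.last = some v) : M.stepKernel σ h {h' | h'.last ≠ some v} = 0 := by
  classical
  obtain ⟨a, ha, ha1⟩ := hv
  rw [show {h' : RunState V Γ | h'.last ≠ some v} = {h' | h'.last = some v}ᶜ from rfl,
    prob_compl_eq_zero_iff MeasurableSet.of_discrete, stepKernel_last_eq]
  obtain rfl | ⟨w, u, rfl⟩ := h.eq_dead_or_mk
  · simp at hh
  · obtain rfl : u = v := by simpa using hh
    have h1 : σ.choice w u a = 1 := by
      rw [PMF.apply_eq_one_iff]
      refine Set.Subset.antisymm (fun γ hγ => ?_) ?_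
      · simpa [ha] using σ.support_subset w u γ hγ
      · obtain ⟨b, hb⟩ := (σ.choice w u).support_nonempty
        have : b = a := by simpa [ha] using σ.support_subset w u b hb
        simpa [this] using hb
    rw [Finset.sum_eq_single u, Finset.sum_eq_single a]
    · simp [h1, ha1]
    · intro γ _ hγ
      rw [M.actProb_eq_zero σ (by simpa [ha] using hγ), zero_mul]
    · simp
    · intro v' _ hv'
      simp [hv'.symm]
    · simp

/-- By the Markov property, the indicator of being in `v` now and elsewhere next integrates to zero,
since the step kernel gives no mass to leaving `v`. -/
lemma IsAbsorbing.ae_last {v : V} (hv : M.IsAbsorbing v) (n : ℕ) :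
    ∀ᵐ θ ∂M.runMeasure σ α, (θ n).last = some v → (θ (n + 1)).last = some v := by
  let g : RunState V Γ → ℝ≥0∞ := Set.indicator {h | h.last ≠ some v} 1
  have h1 := M.lintegral_run_succ σ α n (fun h h' => RunState.atState v h * g h')
  have h2 : ∀ θ : ℕ → RunState V Γ,
      ∫⁻ h', RunState.atState v (θ n) * g h' ∂M.stepKernel σ (θ n) = 0 := by
    intro θ
    rw [lintegral_const_mul _ Measurable.of_discrete,
      lintegral_indicator_one MeasurableSet.of_discrete]
    by_cases hh : (θ n).last = some v
    · rw [hv.stepKernel_last_ne σ hh, mul_zero]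
    · rw [RunState.atState_of_ne hh, zero_mul]
  simp only [h2, lintegral_zero] at h1
  have hm : Measurable fun θ : ℕ → RunState V Γ => RunState.atState v (θ n) * g (θ (n + 1)) :=
    (RunState.measurable_eval n _).mul (RunState.measurable_eval (n + 1) g)
  rw [lintegral_eq_zero_iff hm] at h1
  filter_upwards [h1] with θ hθ h
  by_contra hne
  simp [RunState.atState_of_eq h, g, hne] at hθ

/-- The probability of reaching a set of absorbing states is the limit of the probabilities of
being there at time `n`. -/
lemma tendsto_sum_occ {T : Finset V} (hT : ∀ v ∈ T, M.IsAbsorbing v) :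
    Tendsto (fun n => ∑ v ∈ T, M.occ σ α n v) atTop (𝓝 (M.reachProb σ α T)) := by
  classical
  let A : ℕ → Set (ℕ → RunState V Γ) := fun n => ⋃ v ∈ T, {θ | (θ n).last = some v}
  have memA : ∀ n θ, θ ∈ A n ↔ ∃ v ∈ T, (θ n).last = some v := fun n θ => by simp [A]
  have hA : reachEvent T = ⋃ n, A n := by
    ext θ
    rw [Set.mem_iUnion]
    refine exists_congr fun n => ?_
    rw [memA]
    constructor
    · rintro ⟨w, v, h, hv⟩
      exact ⟨v, hv, congrArg RunState.last h⟩
    · rintro ⟨v, hv, h⟩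
      obtain hn | ⟨w, u, hn⟩ := (θ n).eq_dead_or_mk
      · simp [hn] at h
      · obtain rfl : u = v := by simpa [hn] using h
        exact ⟨w, u, hn, hv⟩
  have hreal : ∀ n, ∑ v ∈ T, M.occ σ α n v = (M.runMeasure σ α).real (A n) := fun n => by
    rw [measureReal_biUnion_finset]
    · rfl
    · intro u _ v _ huv
      refine Set.disjoint_left.2 fun θ hu hv => huv ?_
      simpa using (Eq.symm hu).trans hv
    · exact fun v _ => RunState.measurableSet_last n v
  -- Almost surely `T` is never left, so having visited `T` by time `n` agrees with being in `T` at
  -- time `n` up to a null set. Continuity from below then applies.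
  have hacc : ∀ n, (M.runMeasure σ α) (Set.accumulate A n) = M.runMeasure σ α (A n) := by
    intro n
    refine measure_congr ?_
    have hae : ∀ᵐ θ ∂M.runMeasure σ α, ∀ v ∈ T, ∀ n,
        (θ n).last = some v → (θ (n + 1)).last = some v :=
      (Finset.eventually_all T).2 fun v hv => ae_all_iff.2 fun n => (hT v hv).ae_last σ α n
    filter_upwards [hae] with θ hθ
    refine propext ⟨fun h => ?_, fun h => Set.subset_accumulate h⟩
    obtain ⟨m, hm, h'⟩ := Set.mem_accumulate.1 h
    obtain ⟨v, hv, h'⟩ := (memA m θ).1 h'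
    clear h
    refine (memA n θ).2 ⟨v, hv, ?_⟩
    induction n, hm using Nat.le_induction with
    | base => exact h'
    | succ n _ ih => exact hθ v hv n ih
  simp only [hreal, reachProb, measureReal_def, hA]
  refine (ENNReal.tendsto_toReal (measure_ne_top _ _)).comp ?_
  simpa only [hacc] using tendsto_measure_iUnion_accumulate (μ := M.runMeasure σ α) (f := A)

end MDP

/-! ### Farkas' lemma and polyhedra -/

section Polyhedra

variable {E : Type*} [AddCommGroup E] [Module ℝ E]

/-- **Farkas' lemma**: a linear functional that is nonnegative wherever finitely many given ones
are is a nonnegative combination of them. -/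
theorem exists_nonneg_combination_of_forall_nonneg {ι : Type*} (s : Finset ι)
    (a : ι → E →ₗ[ℝ] ℝ) (b : E →ₗ[ℝ] ℝ) (h : ∀ x, (∀ i ∈ s, 0 ≤ a i x) → 0 ≤ b x) :
    ∃ c : ι → ℝ, (∀ i ∈ s, 0 ≤ c i) ∧ ∀ x, b x = ∑ i ∈ s, c i * a i x := by
  classical
  induction s using Finset.induction_on generalizing a b with
  | empty =>
    refine ⟨0, by simp, fun x => ?_⟩
    have h1 := h x (by simp)
    have h2 := h (-x) (by simp)
    rw [map_neg] at h2
    simp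
    linarith
  | insert j s hj ih =>
    -- Either the constraint `j` is redundant and gets coefficient 0, or some `x₀` satisfies the
    -- others with `b x₀ < 0`, which forces `a j x₀ < 0`.
    by_cases hs : ∀ x, (∀ i ∈ s, 0 ≤ a i x) → 0 ≤ b x
    · obtain ⟨c, hc, hb⟩ := ih a b hs
      refine ⟨Function.update c j 0, fun i hi => ?_, fun x => ?_⟩
      · by_cases hij : i = j
        · simp [hij]
        · simpa [hij] using hc i ((Finset.mem_insert.1 hi).resolve_left hij)
      · rw [Finset.sum_insert hj, hb x]
        simp only [Function.update_self, zero_mul, zero_add]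
        refine Finset.sum_congr rfl fun i hi => ?_
        rw [Function.update_of_ne (ne_of_mem_of_not_mem hi hj)]
    · push Not at hs
      obtain ⟨x₀, hx₀, hbx⟩ := hs
      have ht : a j x₀ < 0 := by
        by_contra! hc
        exact hbx.not_ge (h x₀ ((Finset.forall_mem_insert _ _ _).2 ⟨hc, hx₀⟩))
      -- The new functionals are the old ones composed with the projection along `x₀` onto the
      -- kernel of `a j`. Projected points satisfy the constraint `j` with equality, so the
      -- induction hypothesis applies without it.
      obtain ⟨c, hc, hb⟩ := ih (fun i => a i - (a i x₀ / a j x₀) • a j)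
        (b - (b x₀ / a j x₀) • a j) fun x hx => by
          have := h (x - (a j x / a j x₀) • x₀) ((Finset.forall_mem_insert _ _ _).2
            ⟨by simp [ht.ne], fun i hi => by
              convert hx i hi using 1
              simp
              ring⟩)
          convert this using 1
          simp
          ring
      -- Solving the projected identity for `b` gives this coefficient of `a j`; numerator and
      -- denominator are both nonpositive.
      refine ⟨Function.update c j ((b x₀ - ∑ i ∈ s, c i * a i x₀) / a j x₀),
        fun i hi => ?_, fun x => ?_⟩
      · by_cases hij : i = j
        · subst hij
          rw [Function.update_self]
          refine div_nonneg_of_nonpos ?_ ht.le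
          have := Finset.sum_nonneg fun i hi => mul_nonneg (hc i hi) (hx₀ i hi)
          linarith
        · simpa [hij] using hc i ((Finset.mem_insert.1 hi).resolve_left hij)
      · rw [Finset.sum_insert hj, Function.update_self]
        have h1 : ∑ i ∈ s, Function.update c j ((b x₀ - ∑ i ∈ s, c i * a i x₀) / a j x₀) i
            * a i x = ∑ i ∈ s, c i * a i x := Finset.sum_congr rfl fun i hi => by
          rw [Function.update_of_ne (ne_of_mem_of_not_mem hi hj)]
        have h2 := hb x
        simp only [LinearMap.sub_apply, LinearMap.smul_apply, smul_eq_mul, mul_sub,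
          Finset.sum_sub_distrib] at h2
        have h3 : ∑ i ∈ s, c i * (a i x₀ / a j x₀ * a j x)
            = (∑ i ∈ s, c i * a i x₀) / a j x₀ * a j x := by
          rw [Finset.sum_div, Finset.sum_mul]
          exact Finset.sum_congr rfl fun i _ => by ring
        rw [h1, sub_div, sub_mul, ← h3]
        linarith

lemma isPolyhedron_le (f : E →ₗ[ℝ] ℝ) (c : ℝ) : IsPolyhedron {x | f x ≤ c} :=
  ⟨{(f, c)}, by simp⟩

lemma isPolyhedron_ge (f : E →ₗ[ℝ] ℝ) (c : ℝ) : IsPolyhedron {x | c ≤ f x} :=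
  ⟨{(-f, -c)}, by simp⟩

lemma IsPolyhedron.inter {P Q : Set E} (hP : IsPolyhedron P) (hQ : IsPolyhedron Q) :
    IsPolyhedron (P ∩ Q) := by
  classical
  obtain ⟨S, rfl⟩ := hP
  obtain ⟨T, rfl⟩ := hQ
  refine ⟨S ∪ T, ?_⟩
  ext x
  simp only [Finset.mem_union, or_imp, forall_and]
  rfl

lemma isPolyhedron_eq (f : E →ₗ[ℝ] ℝ) (c : ℝ) : IsPolyhedron {x | f x = c} := by
  have h : {x | f x = c} = {x | f x ≤ c} ∩ {x | c ≤ f x} := by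
    ext x
    exact le_antisymm_iff
  rw [h]
  exact (isPolyhedron_le f c).inter (isPolyhedron_ge f c)

lemma IsPolyhedron.forall_mem {ι : Type*} (s : Finset ι) {P : ι → Set E}
    (hP : ∀ i ∈ s, IsPolyhedron (P i)) : IsPolyhedron {x | ∀ i ∈ s, x ∈ P i} := by
  classical
  induction s using Finset.induction_on with
  | empty => exact ⟨∅, by simp⟩
  | insert j s hj ih =>
    simp only [Finset.forall_mem_insert] at hP ⊢
    exact hP.1.inter (ih hP.2)

lemma IsPolyhedron.convex {P : Set E} (hP : IsPolyhedron P) : Convex ℝ P := by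
  obtain ⟨S, rfl⟩ := hP
  intro x hx y hy s t hs ht hst c hc
  simp only [map_add, map_smul, smul_eq_mul]
  calc s * c.1 x + t * c.1 y ≤ s * c.2 + t * c.2 :=
        add_le_add (mul_le_mul_of_nonneg_left (hx c hc) hs)
          (mul_le_mul_of_nonneg_left (hy c hc) ht)
    _ = c.2 := by rw [← add_mul, hst, one_mul]

end Polyhedra

/-! ### From feasible flows to memoryless strategies -/

/-- If a substochastic matrix has the finite flow `Y` from `a` through the states of `S`, then the
mass absorbed in `g ∉ S` by the chain started in `a` is the flow of `Y` into `g`. -/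
lemma tendsto_absorbed_mass {V : Type*} [DecidableEq V] {S : Finset V} {P : V → V → ℝ}
    {a Y : V → ℝ} {m : ℕ → V → ℝ} {g : V} (hg : g ∉ S) (hP : ∀ u v, 0 ≤ P u v)
    (hP1 : ∀ u, ∑ v ∈ insert g S, P u v ≤ 1) (hm : ∀ n v, 0 ≤ m n v)
    (hY : ∀ v ∈ S, 0 ≤ Y v) (hflow : ∀ v ∈ S, Y v = a v + ∑ u ∈ S, Y u * P u v)
    (hm0 : ∀ v ∈ S, m 0 v = a v) (hmS : ∀ n, ∀ v ∈ S, m (n + 1) v = ∑ u ∈ S, m n u * P u v)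
    (hg0 : m 0 g = 0) (hgS : ∀ n, m (n + 1) g = m n g + ∑ u ∈ S, m n u * P u g) :
    Tendsto (fun n => m n g) atTop (𝓝 (∑ u ∈ S, Y u * P u g)) := by
  -- Expected number of visits before time `n`.
  let Z : ℕ → V → ℝ := fun n v => ∑ j ∈ Finset.range n, m j v
  have hZ : ∀ n v, Z (n + 1) v = Z n v + m n v := fun n v => Finset.sum_range_succ _ _
  have hZsucc : ∀ n, ∀ v ∈ S, Z (n + 1) v = a v + ∑ u ∈ S, Z n u * P u v := by
    intro n v hv
    induction n with
    | zero => simp [Z, hm0 v hv]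
    | succ n ih =>
      rw [hZ, ih, hmS n v hv, add_assoc, ← Finset.sum_add_distrib]
      simp only [hZ, add_mul]
  have hZg : ∀ n, m n g = ∑ u ∈ S, Z n u * P u g := by
    intro n
    induction n with
    | zero => simp [Z, hg0]
    | succ n ih => rw [hgS, ih, ← Finset.sum_add_distrib]; simp only [hZ, add_mul]
  -- `Z` iterates the monotone flow map from 0, so it stays below the nonnegative fixed point `Y`.
  have hZY : ∀ n, ∀ v ∈ S, Z n v ≤ Y v := by
    intro n
    induction n with
    | zero => simpa [Z] using hY
    | succ n ih =>
      intro v hv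
      rw [hZsucc n v hv, hflow v hv]
      gcongr with u hu
      · exact hP u v
      · exact ih u hu
  have hlim : ∀ v ∈ S, ∃ z, Tendsto (fun n => Z n v) atTop (𝓝 z) := fun v hv =>
    ⟨_, tendsto_atTop_ciSup (monotone_nat_of_le_succ fun n => by
      rw [hZ]; linarith [hm n v]) ⟨Y v, by rintro _ ⟨n, rfl⟩; exact hZY n v hv⟩⟩
  choose! z hz using hlim
  have hzY : ∀ v ∈ S, z v ≤ Y v := fun v hv => le_of_tendsto' (hz v hv) fun n => hZY n v hv
  have hsum : ∀ v, Tendsto (fun n => ∑ u ∈ S, Z n u * P u v) atTop (𝓝 (∑ u ∈ S, z u * P u v)) :=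
    fun v => tendsto_finsetSum _ fun u hu => (hz u hu).mul_const _
  have hzflow : ∀ v ∈ S, z v = a v + ∑ u ∈ S, z u * P u v := fun v hv =>
    tendsto_nhds_unique ((tendsto_add_atTop_iff_nat 1).2 (hz v hv)) <| by
      simpa only [hZsucc _ v hv] using (hsum v).const_add (a v)
  -- The excess `Y - z` is a nonnegative circulation: its total mass is already returned to `S`, and
  -- row sums at most 1 leave nothing for `g`.
  have hgap : ∑ u ∈ S, (Y u - z u) * P u g ≤ 0 := by
    have h1 : ∑ v ∈ S, (Y v - z v) = ∑ u ∈ S, (Y u - z u) * ∑ v ∈ S, P u v := by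
      simp only [Finset.mul_sum]
      rw [Finset.sum_comm]
      refine Finset.sum_congr rfl fun v hv => ?_
      rw [hflow v hv, hzflow v hv]
      simp only [sub_mul, Finset.sum_sub_distrib]
      ring
    have h2 : ∑ u ∈ S, (Y u - z u) * (P u g + ∑ v ∈ S, P u v) ≤ ∑ u ∈ S, (Y u - z u) := by
      refine Finset.sum_le_sum fun u hu => ?_
      have := hP1 u
      rw [Finset.sum_insert hg] at this
      exact mul_le_of_le_one_right (sub_nonneg.2 (hzY u hu)) this
    simp only [mul_add, Finset.sum_add_distrib] at h2
    linarith
  have hle : ∑ u ∈ S, z u * P u g ≤ ∑ u ∈ S, Y u * P u g := by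
    gcongr with u hu
    · exact hP u g
    · exact hzY u hu
  have heq : ∑ u ∈ S, Y u * P u g = ∑ u ∈ S, z u * P u g := by
    simp only [sub_mul, Finset.sum_sub_distrib] at hgap
    linarith
  rw [heq]
  simpa only [hZg] using hsum g

/-- Normalize `y`. If its sum is zero, then `y` vanishes on `s` by nonnegativity, and a point mass
works. -/
lemma PMF.exists_proportional {Γ : Type*} {s : Finset Γ} (hs : s.Nonempty) {y : Γ → ℝ}
    (hy : ∀ γ ∈ s, 0 ≤ y γ) : ∃ p : PMF Γ, (∀ γ ∈ p.support, γ ∈ s) ∧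
      ∀ γ ∈ s, (∑ γ' ∈ s, y γ') * (p γ).toReal = y γ := by
  classical
  obtain ⟨γ₀, hγ₀⟩ := hs
  rcases (Finset.sum_nonneg hy).eq_or_lt with h0 | h0
  · refine ⟨PMF.pure γ₀, fun γ hγ => ?_, fun γ hγ => ?_⟩
    · rw [PMF.support_pure, Set.mem_singleton_iff] at hγ
      exact hγ ▸ hγ₀
    · rw [← h0, zero_mul, (Finset.sum_eq_zero_iff_of_nonneg hy).1 h0.symm γ hγ]
  · refine ⟨PMF.ofFinset (fun γ => if γ ∈ s then ENNReal.ofReal (y γ / ∑ γ' ∈ s, y γ') else 0) s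
      ?_ fun γ hγ => if_neg hγ, fun γ hγ => ?_, fun γ hγ => ?_⟩
    · rw [Finset.sum_congr rfl fun γ hγ => if_pos hγ, ← ENNReal.ofReal_sum_of_nonneg
        fun γ hγ => div_nonneg (hy γ hγ) h0.le, ← Finset.sum_div, div_self h0.ne',
        ENNReal.ofReal_one]
    · by_contra h
      simp [h] at hγ
    · rw [PMF.ofFinset_apply, if_pos hγ, ENNReal.toReal_ofReal (div_nonneg (hy γ hγ) h0.le)]
      field_simp

namespace MDP

variable {V Γ : Type*} [Fintype V] {M : MDP V Γ}

lemma IsAbsorbing.exists_prob_eq [DecidableEq V] {v : V} (hv : M.IsAbsorbing v) :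
    ∃ a, M.enabled v = {a} ∧ ∀ v', M.prob v a v' = if v = v' then 1 else 0 := by
  obtain ⟨a, ha, h1⟩ := hv
  refine ⟨a, ha, fun v' => ?_⟩
  split_ifs with h
  · rw [← h, h1]
  · have h2 := M.sum_prob_le_one v a
    have h3 := Finset.add_le_sum (s := Finset.univ) (fun u _ => M.prob_nonneg v a u)
      (Finset.mem_univ v) (Finset.mem_univ v') h
    linarith [M.prob_nonneg v a v']

variable [Fintype Γ] [DecidableEq V]

lemma IsAbsorbing.sum_prob_mul_occAct {v : V} (hv : M.IsAbsorbing v) (σ : M.Strategy) (α : PMF V)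
    (n : ℕ) (v' : V) : ∑ γ ∈ M.enabled v, M.prob v γ v' * M.occAct σ α n v γ
      = if v = v' then M.occ σ α n v' else 0 := by
  obtain ⟨a, ha, h⟩ := hv.exists_prob_eq
  have h1 := M.sum_enabled_occAct σ α n v
  rw [ha, Finset.sum_singleton] at h1 ⊢
  rw [h v', h1]
  split_ifs with hvv
  · rw [hvv, one_mul]
  · rw [zero_mul]

lemma occ_succ_of_absorbing {G : Finset V} (habs : ∀ v ∈ G, M.IsAbsorbing v) (σ : M.Strategy)
    (α : PMF V) (n : ℕ) (v' : V) :
    M.occ σ α (n + 1) v' = (if v' ∈ G then M.occ σ α n v' else 0)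
      + ∑ v ∈ Gᶜ, ∑ γ ∈ M.enabled v, M.prob v γ v' * M.occAct σ α n v γ := by
  rw [occ_succ, ← Finset.sum_add_sum_compl G]
  congr 1
  rw [Finset.sum_congr rfl fun v hv => (habs v hv).sum_prob_mul_occAct σ α n v',
    Finset.sum_ite_eq']

/-- Every feasible point of the linear program is realized by a memoryless strategy. -/
theorem LPFeasible.exists_memoryless {G : Finset V} (habs : ∀ v ∈ G, M.IsAbsorbing v) {α : PMF V}
    (hα : ∀ v ∈ G, α v = 0) {y : (V → ℝ) × (V → Γ → ℝ)} (hy : M.LPFeasible G α y) :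
    ∃ τ : M.Strategy, τ.IsMemoryless ∧ ∀ T ⊆ G, M.reachProb τ α T = ∑ v ∈ T, y.1 v := by
  -- (LP) has no action variables at goal states, so there any distribution on the enabled actions
  -- will do; the weight 0 supplies one.
  have hex : ∀ v, ∃ p : PMF Γ, (∀ γ ∈ p.support, γ ∈ M.enabled v) ∧ (v ∉ G →
      ∀ γ ∈ M.enabled v, (∑ γ' ∈ M.enabled v, y.2 v γ') * (p γ).toReal = y.2 v γ) := by
    intro v
    by_cases hv : v ∈ G
    · obtain ⟨p, hp, -⟩ := PMF.exists_proportional (M.enabled_nonempty v) (y := 0) (by simp)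
      exact ⟨p, hp, fun h => absurd hv h⟩
    · obtain ⟨p, hp, h⟩ := PMF.exists_proportional (M.enabled_nonempty v) (hy.nonneg v hv)
      exact ⟨p, hp, fun _ => h⟩
  choose p hp hpy using hex
  let τ : M.Strategy := ⟨fun _ v => p v, fun _ v => hp v⟩
  have hτ : τ.IsMemoryless := fun _ _ _ => rfl
  let P : V → V → ℝ := fun u v => ∑ γ ∈ M.enabled u, M.prob u γ v * (p u γ).toReal
  let Y : V → ℝ := fun v => ∑ γ ∈ M.enabled v, y.2 v γ
  have hYP : ∀ u ∈ Gᶜ, ∀ v, ∑ γ ∈ M.enabled u, M.prob u γ v * y.2 u γ = Y u * P u v := by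
    intro u hu v
    rw [Finset.mul_sum]
    refine Finset.sum_congr rfl fun γ hγ => ?_
    rw [← hpy u (Finset.mem_compl.1 hu) γ hγ]
    ring
  have hmP : ∀ n u v, ∑ γ ∈ M.enabled u, M.prob u γ v * M.occAct τ α n u γ
      = M.occ τ α n u * P u v := by
    intro n u v
    rw [Finset.mul_sum]
    refine Finset.sum_congr rfl fun γ hγ => ?_
    rw [hτ.occAct_eq]
    ring
  have hP0 : ∀ u v, 0 ≤ P u v := fun u v => Finset.sum_nonneg fun γ _ =>
    mul_nonneg (M.prob_nonneg _ _ _) ENNReal.toReal_nonneg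
  have hp1 : ∀ u, ∑ γ ∈ M.enabled u, (p u γ).toReal = 1 := by
    intro u
    have := (p u).tsum_coe
    rw [tsum_fintype] at this
    rw [Finset.sum_subset (Finset.subset_univ _), ← ENNReal.toReal_sum
      fun γ _ => PMF.apply_ne_top _ _, this, ENNReal.toReal_one]
    intro γ _ hγ
    rw [(PMF.apply_eq_zero_iff _ _).2 fun h => hγ (hp u γ h), ENNReal.toReal_zero]
  have hP1 : ∀ u (s : Finset V), ∑ v ∈ s, P u v ≤ 1 := by
    intro u s
    calc ∑ v ∈ s, P u v ≤ ∑ v, P u v :=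
          Finset.sum_le_sum_of_subset_of_nonneg (Finset.subset_univ _) fun v _ _ => hP0 u v
      _ = ∑ γ ∈ M.enabled u, (∑ v, M.prob u γ v) * (p u γ).toReal := by
          rw [Finset.sum_comm]
          simp only [Finset.sum_mul]
      _ ≤ ∑ γ ∈ M.enabled u, (p u γ).toReal := Finset.sum_le_sum fun γ _ =>
          mul_le_of_le_one_left ENNReal.toReal_nonneg (M.sum_prob_le_one u γ)
      _ = 1 := hp1 u
  have hlim : ∀ g ∈ G, Tendsto (fun n => M.occ τ α n g) atTop (𝓝 (y.1 g)) := by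
    intro g hg
    have hyg : y.1 g = ∑ u ∈ Gᶜ, Y u * P u g := by
      rw [← Finset.sum_congr rfl fun u hu => hYP u hu g]
      linarith [hy.flow_goal g hg]
    rw [hyg]
    -- Each goal state is treated on its own: mass absorbed in the other goal states never returns
    -- to `Gᶜ` and counts as lost.
    refine tendsto_absorbed_mass (a := fun v => (α v).toReal) (by simpa using hg) hP0
      (fun u => hP1 u _) (M.occ_nonneg τ α) (fun v hv => Finset.sum_nonneg
        (hy.nonneg v (Finset.mem_compl.1 hv))) (fun v hv => ?_) (fun v _ => M.occ_zero τ α v)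
      (fun n v hv => ?_) ?_ fun n => ?_
    · rw [← Finset.sum_congr rfl fun u hu => hYP u hu v]
      linarith [hy.flow v (Finset.mem_compl.1 hv)]
    · rw [occ_succ_of_absorbing habs, if_neg (Finset.mem_compl.1 hv), zero_add]
      simp only [hmP]
    · rw [occ_zero, hα g hg, ENNReal.toReal_zero]
    · rw [occ_succ_of_absorbing habs, if_pos hg]
      simp only [hmP]
  refine ⟨τ, hτ, fun T hT => ?_⟩
  exact tendsto_nhds_unique (tendsto_sum_occ τ α fun v hv => habs v (hT hv))
    (tendsto_finsetSum _ fun v hv => hlim v (hT hv))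

/-! ### Superharmonic functions -/

/-- A function that no action can increase in expectation is nonnegative on a cleaned-up MDP if
it is nonnegative on the goal. -/
lemma IsCleanedUp.nonneg_of_superharmonic {G : Finset V} (hclean : M.IsCleanedUp G)
    (habs : ∀ v ∈ G, M.IsAbsorbing v) {h : V → ℝ} (hG : ∀ v ∈ G, 0 ≤ h v)
    (hsup : ∀ v, ∀ γ ∈ M.enabled v, ∑ v', M.prob v γ v' * h v' ≤ h v) (v : V) : 0 ≤ h v := by
  by_contra! hv
  obtain ⟨u, -, hu⟩ := Finset.exists_min_image Finset.univ h ⟨v, Finset.mem_univ v⟩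
  have hu0 : h u < 0 := (hu v (Finset.mem_univ v)).trans_lt hv
  -- The minimizers of `h` are closed under transitions. The missing mass goes to the dead state, of
  -- value 0, which exceeds the negative minimum; hence no mass can be lost or leave the minimizers.
  have hclosed : ∀ w, h w = h u → ∀ γ ∈ M.enabled w, ∀ w', h w' ≠ h u →
      M.prob w γ w' = 0 := by
    intro w hw γ hγ w' hw'
    have h1 : ∑ v', M.prob w γ v' * (h v' - h u) ≤ 0 := by
      simp only [mul_sub, Finset.sum_sub_distrib, ← Finset.sum_mul]
      nlinarith [hsup w γ hγ, M.sum_prob_le_one w γ]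
    have h2 : ∀ v' ∈ Finset.univ, 0 ≤ M.prob w γ v' * (h v' - h u) := fun v' hv' =>
      mul_nonneg (M.prob_nonneg _ _ _) (sub_nonneg.2 (hu v' hv'))
    have h3 := (Finset.sum_eq_zero_iff_of_nonneg h2).1
      (h1.antisymm (Finset.sum_nonneg h2)) w' (Finset.mem_univ w')
    exact (mul_eq_zero.1 h3).resolve_right (sub_ne_zero.2 hw')
  obtain ⟨σ, hσ⟩ := hclean u fun h => hu0.not_ge (hG u h)
  -- A run from `u` stays among the minimizers, hence outside `G`, where `h` is nonnegative; this
  -- contradicts the choice of `σ`.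
  have hocc : ∀ n w, h w ≠ h u → M.occ σ (PMF.pure u) n w = 0 := by
    intro n
    induction n with
    | zero =>
      intro w hw
      rw [occ_zero, PMF.pure_apply, if_neg fun h => hw (by rw [h]), ENNReal.toReal_zero]
    | succ n ih =>
      intro w hw
      rw [occ_succ]
      refine Finset.sum_eq_zero fun w' _ => Finset.sum_eq_zero fun γ hγ => ?_
      by_cases hw' : h w' = h u
      · rw [hclosed w' hw' γ hγ w hw, zero_mul]
      · have h1 := M.sum_enabled_occAct σ (PMF.pure u) n w'
        rw [ih w' hw'] at h1
        rw [(Finset.sum_eq_zero_iff_of_nonneg fun γ _ => M.occAct_nonneg σ _ n w' γ).1 h1 γ hγ,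
          mul_zero]
  have hlim := tendsto_sum_occ σ (PMF.pure u) habs
  have hzero : ∀ n, ∑ w ∈ G, M.occ σ (PMF.pure u) n w = 0 := fun n =>
    Finset.sum_eq_zero fun w hw => hocc n w (hu0.trans_le (hG w hw)).ne'
  simp only [hzero] at hlim
  exact hσ.ne (tendsto_nhds_unique tendsto_const_nhds hlim)

/-- The expectation of a superharmonic function does not increase along a run. -/
lemma sum_occ_mul_le {h : V → ℝ}
    (hsup : ∀ v, ∀ γ ∈ M.enabled v, ∑ v', M.prob v γ v' * h v' ≤ h v)
    (σ : M.Strategy) (α : PMF V) (n : ℕ) :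
    ∑ v, M.occ σ α n v * h v ≤ ∑ v, (α v).toReal * h v := by
  induction n with
  | zero => simp only [occ_zero, le_refl]
  | succ n ih =>
    refine le_trans ?_ ih
    calc ∑ v', M.occ σ α (n + 1) v' * h v'
        = ∑ v, ∑ γ ∈ M.enabled v, M.occAct σ α n v γ * ∑ v', M.prob v γ v' * h v' := by
          simp only [occ_succ, Finset.sum_mul, Finset.mul_sum]
          rw [Finset.sum_comm]
          refine Finset.sum_congr rfl fun v _ => ?_
          rw [Finset.sum_comm]
          exact Finset.sum_congr rfl fun γ _ => Finset.sum_congr rfl fun v' _ => by ring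
      _ ≤ ∑ v, ∑ γ ∈ M.enabled v, M.occAct σ α n v γ * h v :=
          Finset.sum_le_sum fun v _ => Finset.sum_le_sum fun γ hγ =>
            mul_le_mul_of_nonneg_left (hsup v γ hγ) (M.occAct_nonneg σ α n v γ)
      _ = ∑ v, M.occ σ α n v * h v := by
          simp only [← Finset.sum_mul, sum_enabled_occAct]

end MDP

/-! ### Duality: from strategies to feasible flows -/

namespace MDP

variable {V Γ : Type*} [DecidableEq V] {k : ℕ}

lemma subset_goal (F : Fin k → Finset V) (i : Fin k) : F i ⊆ goal F :=
  Finset.subset_biUnion_of_mem F (Finset.mem_univ i)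

/-- The function equal to `x.1` outside the goal, and on the goal to the total weight, under
`x.2`, of the targets containing the given state. -/
def goalExtend (F : Fin k → Finset V) : (V → ℝ) × (Fin k → ℝ) →ₗ[ℝ] V → ℝ where
  toFun x v := if v ∈ goal F then ∑ i, (if v ∈ F i then x.2 i else 0) else x.1 v
  map_add' x y := by
    ext v
    by_cases hv : v ∈ goal F
    · simp only [hv, if_true, Prod.snd_add, Pi.add_apply, ← Finset.sum_add_distrib]
      exact Finset.sum_congr rfl fun i _ => by split_ifs <;> simp
    · simp [hv]
  map_smul' c x := by
    ext v
    by_cases hv : v ∈ goal F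
    · simp [hv, Finset.mul_sum]
    · simp [hv]

lemma goalExtend_of_mem {F : Fin k → Finset V} {v : V} (hv : v ∈ goal F)
    (x : (V → ℝ) × (Fin k → ℝ)) : goalExtend F x v = ∑ i, if v ∈ F i then x.2 i else 0 :=
  if_pos hv

lemma goalExtend_of_notMem {F : Fin k → Finset V} {v : V} (hv : v ∉ goal F)
    (x : (V → ℝ) × (Fin k → ℝ)) : goalExtend F x v = x.1 v :=
  if_neg hv

lemma goalExtend_single_fst {F : Fin k → Finset V} {v : V} (hv : v ∉ goal F) :
    goalExtend F (Pi.single v 1, 0) = Pi.single v 1 := by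
  ext u
  by_cases hu : u ∈ goal F
  · rw [goalExtend_of_mem hu, Pi.single_eq_of_ne (ne_of_mem_of_not_mem hu hv)]
    simp
  · rw [goalExtend_of_notMem hu]

lemma goalExtend_single_snd (F : Fin k → Finset V) (i : Fin k) (u : V) :
    goalExtend F (0, Pi.single i 1) u = if u ∈ F i then 1 else 0 := by
  by_cases hu : u ∈ goal F
  · rw [goalExtend_of_mem hu, Finset.sum_eq_single i]
    · simp
    · intro j _ hj
      simp [hj]
    · simp
  · rw [goalExtend_of_notMem hu, if_neg fun h => hu (subset_goal F i h)]
    rfl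

/-- Double counting of the pairs of a target and a state in it; a state lying in several targets
carries the sum of their weights. -/
lemma sum_mul_goalExtend (F : Fin k → Finset V) (m : V → ℝ) (x : (V → ℝ) × (Fin k → ℝ)) :
    ∑ v ∈ goal F, m v * goalExtend F x v = ∑ i, x.2 i * ∑ v ∈ F i, m v := by
  rw [Finset.sum_congr rfl fun v hv => by rw [goalExtend_of_mem hv]]
  simp only [Finset.mul_sum]
  rw [Finset.sum_comm]
  refine Finset.sum_congr rfl fun i _ => ?_
  rw [← Finset.sum_subset (subset_goal F i) fun v _ hv => by rw [if_neg hv, mul_zero]]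
  exact Finset.sum_congr rfl fun v hv => by rw [if_pos hv, mul_comm]

variable [Fintype V]

theorem isPolyhedron_lpPolyhedron (M : MDP V Γ) (F : Fin k → Finset V) (α : PMF V) :
    IsPolyhedron (M.lpPolyhedron F α) := by
  let E := ((V → ℝ) × (V → Γ → ℝ)) × (Fin k → ℝ)
  let goalAt (v : V) : E →ₗ[ℝ] ℝ := LinearMap.proj v ∘ₗ LinearMap.fst ℝ _ _ ∘ₗ LinearMap.fst ℝ _ _
  let actAt (v : V) (γ : Γ) : E →ₗ[ℝ] ℝ :=
    LinearMap.proj γ ∘ₗ LinearMap.proj v ∘ₗ LinearMap.snd ℝ _ _ ∘ₗ LinearMap.fst ℝ _ _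
  let objAt (i : Fin k) : E →ₗ[ℝ] ℝ := LinearMap.proj i ∘ₗ LinearMap.snd ℝ _ _
  let inflow (v : V) : E →ₗ[ℝ] ℝ :=
    ∑ v' ∈ (goal F)ᶜ, ∑ γ' ∈ M.enabled v', M.prob v' γ' v • actAt v' γ'
  have hset : M.lpPolyhedron F α =
      {x | ∀ v ∈ (goal F)ᶜ, x ∈ {x | (∑ γ ∈ M.enabled v, actAt v γ - inflow v) x
        = (α v).toReal}} ∩
      ({x | ∀ v ∈ goal F, x ∈ {x | (goalAt v - inflow v) x = 0}} ∩
      ({x | ∀ v ∈ goal F, x ∈ {x | 0 ≤ goalAt v x}} ∩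
      ({x | ∀ v ∈ (goal F)ᶜ, x ∈ {x | ∀ γ ∈ M.enabled v, x ∈ {x | 0 ≤ actAt v γ x}}} ∩
      {x | ∀ i ∈ Finset.univ, x ∈ {x | 0 ≤ objAt i x} ∩
        {x | (objAt i - ∑ v ∈ F i, goalAt v) x ≤ 0}}))) := by
    ext x
    simp only [lpPolyhedron, Set.mem_inter_iff, Set.mem_ofPred_eq, inflow,
      LinearMap.sub_apply, LinearMap.sum_apply, LinearMap.smul_apply, smul_eq_mul,
      Finset.mem_compl, Finset.mem_univ, forall_const, sub_nonpos]
    exact ⟨fun ⟨⟨h1, h2, h3, h4⟩, h5⟩ => ⟨h1, h2, h3, h4, h5⟩,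
      fun ⟨h1, h2, h3, h4, h5⟩ => ⟨⟨h1, h2, h3, h4⟩, h5⟩⟩
  rw [hset]
  exact (IsPolyhedron.forall_mem _ fun v _ => isPolyhedron_eq _ _).inter <|
    (IsPolyhedron.forall_mem _ fun v _ => isPolyhedron_eq _ _).inter <|
    (IsPolyhedron.forall_mem _ fun v _ => isPolyhedron_ge _ _).inter <|
    (IsPolyhedron.forall_mem _ fun v _ =>
      IsPolyhedron.forall_mem _ fun γ _ => isPolyhedron_ge _ _).inter <|
    IsPolyhedron.forall_mem _ fun i _ => (isPolyhedron_ge _ _).inter (isPolyhedron_le _ _)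

variable {M : MDP V Γ} [Fintype Γ]

/-- The weak-duality bound: a superharmonic extension of a weighting of the targets bounds the
weighted reachability probabilities of every strategy. -/
lemma sum_mul_reachProb_le {F : Fin k → Finset V} (hclean : M.IsCleanedUp (goal F))
    (habs : ∀ v ∈ goal F, M.IsAbsorbing v) {α : PMF V} (hα : ∀ v ∈ goal F, α v = 0)
    (σ : M.Strategy) {x : (V → ℝ) × (Fin k → ℝ)} (hx : ∀ i, 0 ≤ x.2 i)
    (hsup : ∀ v, v ∉ goal F → ∀ γ ∈ M.enabled v,
      ∑ v', M.prob v γ v' * goalExtend F x v' ≤ x.1 v) :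
    ∑ i, x.2 i * M.reachProb σ α (F i) ≤ ∑ v, (α v).toReal * x.1 v := by
  have hG : ∀ v ∈ goal F, 0 ≤ goalExtend F x v := fun v hv => by
    rw [goalExtend_of_mem hv]
    exact Finset.sum_nonneg fun i _ => by split_ifs <;> simp [hx]
  have hsup' : ∀ v, ∀ γ ∈ M.enabled v,
      ∑ v', M.prob v γ v' * goalExtend F x v' ≤ goalExtend F x v := by
    intro v γ hγ
    by_cases hv : v ∈ goal F
    · obtain ⟨a, ha, h⟩ := (habs v hv).exists_prob_eq
      obtain rfl : γ = a := by simpa [ha] using hγ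
      simp [h]
    · rw [goalExtend_of_notMem hv]
      exact hsup v hv γ hγ
  have h0 := hclean.nonneg_of_superharmonic habs hG hsup'
  have hα' : ∑ v, (α v).toReal * goalExtend F x v = ∑ v, (α v).toReal * x.1 v := by
    refine Finset.sum_congr rfl fun v _ => ?_
    by_cases hv : v ∈ goal F
    · simp [hα v hv]
    · rw [goalExtend_of_notMem hv]
  have hlim : Tendsto (fun n => ∑ i, x.2 i * ∑ v ∈ F i, M.occ σ α n v) atTop
      (𝓝 (∑ i, x.2 i * M.reachProb σ α (F i))) :=
    tendsto_finsetSum _ fun i _ => (tendsto_sum_occ σ α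
      fun v hv => habs v (subset_goal F i hv)).const_mul _
  refine le_of_tendsto' hlim fun n => ?_
  rw [← sum_mul_goalExtend, ← hα']
  -- The terms outside the goal can be dropped because the superharmonic function is nonnegative,
  -- which is what `hclean` provides.
  exact (Finset.sum_le_sum_of_subset_of_nonneg (Finset.subset_univ _) fun v _ _ =>
    mul_nonneg (M.occ_nonneg σ α n v) (h0 v)).trans (sum_occ_mul_le hsup' σ α n)

/-- The reachability probabilities of every strategy are dominated by a feasible point of the
linear program. -/
theorem exists_lpFeasible {F : Fin k → Finset V} (hclean : M.IsCleanedUp (goal F))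
    (habs : ∀ v ∈ goal F, M.IsAbsorbing v) {α : PMF V} (hα : ∀ v ∈ goal F, α v = 0)
    (σ : M.Strategy) : ∃ y, M.LPFeasible (goal F) α y ∧
      ∀ i, M.reachProb σ α (F i) ≤ ∑ v ∈ F i, y.1 v := by
  let fstAt (v : V) : (V → ℝ) × (Fin k → ℝ) →ₗ[ℝ] ℝ := LinearMap.proj v ∘ₗ LinearMap.fst ℝ _ _
  let sndAt (i : Fin k) : (V → ℝ) × (Fin k → ℝ) →ₗ[ℝ] ℝ := LinearMap.proj i ∘ₗ LinearMap.snd ℝ _ _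
  let extAt (v : V) : (V → ℝ) × (Fin k → ℝ) →ₗ[ℝ] ℝ := LinearMap.proj v ∘ₗ goalExtend F
  -- The functionals `a` express superharmonicity at a state-action pair and nonnegativity of a
  -- target weight; `b` is the slack in the weak-duality bound. Farkas multipliers of the first kind
  -- become the flow, those of the second kind the surplus over `reachProb`.
  let a : (Σ _ : V, Γ) ⊕ Fin k → (V → ℝ) × (Fin k → ℝ) →ₗ[ℝ] ℝ :=
    Sum.elim (fun p => fstAt p.1 - ∑ v', M.prob p.1 p.2 v' • extAt v') sndAt
  let b : (V → ℝ) × (Fin k → ℝ) →ₗ[ℝ] ℝ := ∑ v, (α v).toReal • fstAt v - ∑ i, M.reachProb σ α (F i) • sndAt i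
  have ha : ∀ v γ x, a (Sum.inl ⟨v, γ⟩) x
      = x.1 v - ∑ v', M.prob v γ v' * goalExtend F x v' := fun v γ x => by
    simp [a, fstAt, extAt, LinearMap.sum_apply]
  have ha' : ∀ i x, a (Sum.inr i) x = x.2 i := fun i x => rfl
  have hb : ∀ x, b x = ∑ v, (α v).toReal * x.1 v - ∑ i, x.2 i * M.reachProb σ α (F i) :=
    fun x => by simp [b, fstAt, sndAt, LinearMap.sum_apply, mul_comm]
  obtain ⟨c, hc, hbc⟩ := exists_nonneg_combination_of_forall_nonneg
    (((goal F)ᶜ.sigma M.enabled).disjSum Finset.univ) a b fun x hx => by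
      rw [hb, sub_nonneg]
      refine sum_mul_reachProb_le hclean habs hα σ (fun i => ?_) fun v hv γ hγ => ?_
      · exact hx (Sum.inr i) (by simp)
      · have := hx (Sum.inl ⟨v, γ⟩) (by simp [hv, hγ])
        rwa [ha, sub_nonneg] at this
  simp only [hb, Finset.sum_disjSum, Finset.sum_sigma, ha, ha'] at hbc
  have hc' : ∀ v, v ∉ goal F → ∀ γ ∈ M.enabled v, 0 ≤ c (Sum.inl ⟨v, γ⟩) :=
    fun v hv γ hγ => hc _ (by simp [hv, hγ])
  refine ⟨(fun v => ∑ v' ∈ (goal F)ᶜ, ∑ γ' ∈ M.enabled v',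
    M.prob v' γ' v * c (Sum.inl ⟨v', γ'⟩), fun v γ => c (Sum.inl ⟨v, γ⟩)),
    ⟨fun v hv => ?_, fun v _ => sub_self _, fun v _ => ?_, hc'⟩, fun i => ?_⟩
  -- Comparing the coefficients of `x.1 v` on both sides gives flow conservation at `v`.
  · have h := hbc (Pi.single v 1, 0)
    rw [goalExtend_single_fst hv] at h
    simp only [Pi.single_apply, mul_ite, mul_one, mul_zero, Finset.sum_ite_eq', Finset.mem_univ,
      if_true, Pi.zero_apply, zero_mul, Finset.sum_const_zero, sub_zero, add_zero, mul_sub,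
      Finset.sum_sub_distrib] at h
    rw [h]
    congr 1
    · rw [Finset.sum_eq_single v]
      · simp
      · intro u _ hu
        simp [hu]
      · simp [hv]
    · simp only [mul_comm]
  · exact Finset.sum_nonneg fun u hu => Finset.sum_nonneg fun γ hγ =>
      mul_nonneg (M.prob_nonneg _ _ _) (hc' u (Finset.mem_compl.1 hu) γ hγ)
  -- Comparing the coefficients of the weight of target `i` shows that the flow into `F i` is
  -- `reachProb` plus the nonnegative multiplier `c (Sum.inr i)`.
  · have h := hbc (0, Pi.single i 1)
    simp only [goalExtend_single_snd, Pi.single_apply, mul_ite, mul_one, mul_zero, ite_mul,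
      one_mul, zero_mul, Finset.sum_ite_eq', Finset.mem_univ, if_true, Pi.zero_apply,
      Finset.sum_const_zero, zero_sub, mul_neg, Finset.sum_neg_distrib, Finset.sum_ite_mem,
      Finset.univ_inter] at h
    have hi := hc (Sum.inr i) (by simp)
    have hsum : ∑ v ∈ F i, ∑ v' ∈ (goal F)ᶜ, ∑ γ' ∈ M.enabled v',
        M.prob v' γ' v * c (Sum.inl ⟨v', γ'⟩) = ∑ v' ∈ (goal F)ᶜ, ∑ γ' ∈ M.enabled v',
        c (Sum.inl ⟨v', γ'⟩) * ∑ v ∈ F i, M.prob v' γ' v := by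
      rw [Finset.sum_comm]
      refine Finset.sum_congr rfl fun v' _ => ?_
      rw [Finset.sum_comm]
      simp only [← Finset.sum_mul, mul_comm]
    change _ ≤ ∑ v ∈ F i, ∑ v' ∈ (goal F)ᶜ, ∑ γ' ∈ M.enabled v',
        M.prob v' γ' v * c (Sum.inl ⟨v', γ'⟩)
    rw [hsum]
    linarith

end MDP

/-! ### The equivalences and the achievable set -/

theorem mainTheorem2 {V Γ : Type*} [Fintype V] [DecidableEq V] [Fintype Γ]
    (M : MDP V Γ) {k : ℕ} (F : Fin k → Finset V)
    (hclean : M.IsCleanedUp (MDP.goal F))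
    (habs : ∀ v ∈ MDP.goal F, M.IsAbsorbing v)
    (α : PMF V) (hα : ∀ v ∈ MDP.goal F, α v = 0) :
    (∀ r : Fin k → ℝ, (∀ i, 0 < r i ∧ r i ≤ 1) →
      List.TFAE [
        ∃ σ : M.Strategy, σ.IsMemoryless ∧ ∀ i, r i ≤ M.reachProb σ α (F i),
        ∃ y, M.LPFeasible (MDP.goal F) α y ∧ ∀ i, r i ≤ ∑ v ∈ F i, y.1 v,
        ∃ σ : M.Strategy, ∀ i, r i ≤ M.reachProb σ α (F i)]) ∧
    (∀ σ : M.Strategy, ∃ τ : M.Strategy, τ.IsMemoryless ∧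
      ∀ i, M.reachProb σ α (F i) ≤ M.reachProb τ α (F i)) ∧
    IsPolyhedron (M.lpPolyhedron F α) ∧
    M.achievableSet F α = Prod.snd '' M.lpPolyhedron F α ∧
    Convex ℝ (M.achievableSet F α) := by
  have hrealize : ∀ y, M.LPFeasible (MDP.goal F) α y → ∃ τ : M.Strategy, τ.IsMemoryless ∧
      ∀ i, M.reachProb τ α (F i) = ∑ v ∈ F i, y.1 v := fun y hy =>
    let ⟨τ, hτ, h⟩ := hy.exists_memoryless habs hα
    ⟨τ, hτ, fun i => h _ (MDP.subset_goal F i)⟩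
  have hpoly := MDP.isPolyhedron_lpPolyhedron M F α
  have himage : M.achievableSet F α = Prod.snd '' M.lpPolyhedron F α := by
    ext r
    constructor
    · rintro ⟨hr, σ, hσ⟩
      obtain ⟨y, hy, h⟩ := MDP.exists_lpFeasible hclean habs hα σ
      exact ⟨(y, r), ⟨hy, fun i => ⟨hr i, (hσ i).trans (h i)⟩⟩, rfl⟩
    · rintro ⟨⟨y, r⟩, ⟨hy, h⟩, rfl⟩
      obtain ⟨τ, -, hτ⟩ := hrealize y hy
      exact ⟨fun i => (h i).1, τ, fun i => (h i).2.trans (hτ i).ge⟩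
  refine ⟨fun r _ => ?_, fun σ => ?_, hpoly, himage, ?_⟩
  · tfae_have 1 → 3 := fun ⟨σ, _, h⟩ => ⟨σ, h⟩
    tfae_have 3 → 2 := fun ⟨σ, h⟩ =>
      let ⟨y, hy, h'⟩ := MDP.exists_lpFeasible hclean habs hα σ
      ⟨y, hy, fun i => (h i).trans (h' i)⟩
    tfae_have 2 → 1 := fun ⟨y, hy, h⟩ =>
      let ⟨τ, hτ, h'⟩ := hrealize y hy
      ⟨τ, hτ, fun i => (h i).trans (h' i).ge⟩
    tfae_finish
  · obtain ⟨y, hy, h⟩ := MDP.exists_lpFeasible hclean habs hα σ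
    obtain ⟨τ, hτ, h'⟩ := hrealize y hy
    exact ⟨τ, hτ, fun i => (h i).trans (h' i).ge⟩
  · rw [himage]
    exact hpoly.convex.linear_image (LinearMap.snd ℝ _ _)
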